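/- Let $d$ be a positive integer with $d\equiv 1 \pmod 8$, and fix a sign $\varepsilon\in\{+1,-1\}$. Let $N_d^2$ be the rank-two lattice $N_d^2=[h,\alpha,(h+\alpha)/2]=\{(xh+y\alpha)/2 : x,y\in\mathbb Z,\ x\equiv y \bmod 2\}$ with $h^2=2$, $\alpha^2=-2d$, $h\cdot\alpha=0$ (a lattice being a free $\mathbb Z$-module of finite rank with a nondegenerate symmetric $\mathbb Z$-valued bilinear form). (1) The equation $a^2-db^2=8\varepsilon$ has a solution $(a,b)$ in $\mathbb Z_p$ for every prime $p$ if and only if $$\left(\frac{2\varepsilon}{p}\right)=1\quad\text{for every odd prime } p\mid d. \qquad (*)$$ (2) For each prime $p$, the equation $a^2-db^2=8\varepsilon$ has a solution in $\mathbb Z_p$ if and only if the lattice $N_d^2\otimes\mathbb Z_p$ has an element $h_1$ with $h_1^2=4\varepsilon$. (3) For every odd prime $p$, $\left(\frac{2}{p}\right)=(-1)^{(p^2-1)/8}$ and $\left(\frac{-2}{p}\right)=(-1)^{(p^2-1)/8+(p-1)/2}$. (4) If the genus of $N_d^2$ has only one class (that is, every lattice $M$ with $M\otimes\mathbb Z_p\cong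 N_d^2\otimes\mathbb Z_p$ for all primes $p$ and $M\otimes\mathbb R\cong N_d^2\otimes\mathbb R$ is isometric to $N_d^2$), then $a^2-db^2=8\varepsilon$ has an integral solution $(a,b)$ if and only if $(*)$ holds. -/

import Mathlib

open scoped TensorProduct

/-- A (nondegenerate, integral, symmetric) lattice: a symmetric nondegenerate `ℤ`-valued bilinear
form on a free `ℤ`-module of finite rank. -/
structure IsLatticeForm {L : Type*} [AddCommGroup L] (B : LinearMap.BilinForm ℤ L) : Prop where
  free : Module.Free ℤ L
  finite : Module.Finite ℤ L
  symm : B.IsSymm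
  nondegenerate : B.Nondegenerate

/-- Two bilinear modules over `R` are isometric. -/
def IsIsometric {R M N : Type*} [CommRing R] [AddCommGroup M] [Module R M] [AddCommGroup N]
    [Module R N] (B : LinearMap.BilinForm R M) (C : LinearMap.BilinForm R N) : Prop :=
  ∃ e : M ≃ₗ[R] N, ∀ x y : M, C (e x) (e y) = B x y

/-- Two integral bilinear modules are in the same genus: they become isometric over `ℤ_p` for
every prime `p`, and over `ℝ` (equality of signatures). -/
def SameGenus {L M : Type*} [AddCommGroup L] [AddCommGroup M] (B : LinearMap.BilinForm ℤ L)
    (C : LinearMap.BilinForm ℤ M) : Prop :=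
  (∀ (p : ℕ) [Fact p.Prime],
    IsIsometric (LinearMap.BilinForm.baseChange ℤ_[p] B)
      (LinearMap.BilinForm.baseChange ℤ_[p] C)) ∧
  IsIsometric (LinearMap.BilinForm.baseChange ℝ B) (LinearMap.BilinForm.baseChange ℝ C)

/-- The genus of the lattice `(L, B)` has only one class: every lattice in the genus of `(L, B)`
is isometric to `(L, B)`. -/
def GenusHasOneClass {L : Type*} [AddCommGroup L] (B : LinearMap.BilinForm ℤ L) : Prop :=
  ∀ (M : Type) [AddCommGroup M] (C : LinearMap.BilinForm ℤ M),
    IsLatticeForm C → SameGenus B C → IsIsometric B C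

/-- The form of the lattice `N_d^2 = [h, α, (h + α) / 2]`, where `h² = 2`, `α² = -2d`, `h ⊥ α`
(for `d ≡ 1 mod 4`), on `ℤ²`, written in the basis `h`, `(h + α) / 2`. -/
noncomputable def latticeN2 (d : ℕ) : LinearMap.BilinForm ℤ (Fin 2 → ℤ) :=
  Matrix.toBilin' !![2, 1; 1, (1 - (d : ℤ)) / 2]

theorem latticeN2_apply (d : ℕ) (x y : Fin 2 → ℤ) :
    latticeN2 d x y =
      2 * (x 0 * y 0) + x 0 * y 1 + x 1 * y 0 + (1 - (d : ℤ)) / 2 * (x 1 * y 1) := by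
  simp [latticeN2, Matrix.toBilin'_apply, Fin.sum_univ_two]
  ring

/-- In `ℤ²` the elements `h = (1, 0)` and `α = (-1, 2)` satisfy `h² = 2`, `α² = -2d`, `h ⊥ α`,
and `(h + α) / 2` is the second basis vector. -/
theorem latticeN2_spec (d : ℕ) (hd : d ≡ 1 [MOD 4]) :
    latticeN2 d ![1, 0] ![1, 0] = 2 ∧ latticeN2 d ![-1, 2] ![-1, 2] = -2 * (d : ℤ) ∧
      latticeN2 d ![1, 0] ![-1, 2] = 0 ∧
      (![1, 0] + ![-1, 2] : Fin 2 → ℤ) = (2 : ℤ) • ![0, 1] := by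
  unfold Nat.ModEq at hd
  refine ⟨?_, ?_, ?_, ?_⟩
  · simp [latticeN2_apply]
  · simp [latticeN2_apply]; omega
  · simp [latticeN2_apply]
  · ext i; fin_cases i <;> simp

/-- `N_d^2` is a lattice. -/
theorem latticeN2_isLatticeForm (d : ℕ) (hd : d ≡ 1 [MOD 4]) : IsLatticeForm (latticeN2 d) where
  free := inferInstance
  finite := inferInstance
  symm := ⟨fun x y => by simp only [latticeN2_apply, RingHom.id_apply]; ring⟩
  nondegenerate := by
    unfold Nat.ModEq at hd
    refine LinearMap.BilinForm.nondegenerate_toBilin'_iff_det_ne_zero.mpr ?_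
    rw [Matrix.det_fin_two_of]
    omega

/-!
Write `m = (d - 1) / 8`. Besides `N = N_d^2`, consider the lattice `M` with Gram matrix
`!![4ε, 1; 1, -2εm]` (`latticeGenus`), which visibly represents `4ε` and has the same determinant
`-d` as `N`. Up to the factor `2`, `N` is the norm form of the quadratic order
`ℤ[ω]`, `ω = (1 + √d) / 2`, and `M` is the norm form on the ideal `(2, εω)` divided by its norm,
twisted by `ε`.
If `λ = (a + b√d) / 2` has norm `2ε` over a ring `R` and `a + b = 4w`, i.e. if
`2w² - wb - mb² = ε`, then multiplication by `λ / 2` is an isometry `M ⊗ R ≅ N ⊗ R`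
(`isIsometric_baseChange_latticeGenus`).

For `R = ℤ_p` with `p` odd and for `R = ℝ` the division by `4` is harmless, so any solution of
`a² - db² = 8ε` gives such an isometry. For `p = 2` one can take `b = 1` and solve for `w` by
Hensel's lemma, since the derivative `4w - 1` is a unit. For odd `p ∤ d` the equation
`a² - db² = 8ε` is solvable by counting squares in `ZMod p` and Hensel lifting, and for odd `p ∣ d`
its solvability means that `8ε` is a nonzero square mod `p`. So the Legendre condition puts `M` in
the genus of `N`; if that genus has one class, `N` represents `4ε` over `ℤ`, and
`2 (x h + y (h + α) / 2)² = (2x + y)² - d y²` turns this into an integral solution.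
-/

/-! ### Hensel lifting and squares in `ℤ_p` -/

open Polynomial in
/-- Hensel's lemma for simple roots modulo `p`, without monicity. -/
theorem PadicInt.exists_root_of_toZMod {p : ℕ} [Fact p.Prime] (F : ℤ_[p][X]) (a : ℤ_[p])
    (h0 : PadicInt.toZMod (F.eval a) = 0) (h1 : PadicInt.toZMod (F.derivative.eval a) ≠ 0) :
    ∃ z : ℤ_[p], F.eval z = 0 := by
  have key : ∀ x : ℤ_[p], PadicInt.toZMod x = 0 ↔ ‖x‖ < 1 := fun x => by
    rw [← RingHom.mem_ker, PadicInt.ker_toZMod, IsLocalRing.mem_maximalIdeal,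
      PadicInt.mem_nonunits]
  have hu : ‖F.derivative.eval a‖ = 1 :=
    le_antisymm (PadicInt.norm_le_one _) (not_lt.mp (mt (key _).mpr h1))
  obtain ⟨z, hz, -⟩ := hensels_lemma (F := F) (a := a) (by
    simpa [Polynomial.coe_aeval_eq_eval, hu] using (key _).mp h0)
  exact ⟨z, by simpa [Polynomial.coe_aeval_eq_eval] using hz⟩

theorem ZMod.two_ne_zero_of_ne_two {p : ℕ} [Fact p.Prime] (hp : p ≠ 2) : (2 : ZMod p) ≠ 0 :=
  Ring.two_ne_zero (by rwa [ZMod.ringChar_zmod_n])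

open Polynomial in
theorem PadicInt.isSquare_of_toZMod {p : ℕ} [Fact p.Prime] (hp : p ≠ 2) (c : ℤ_[p])
    (h0 : PadicInt.toZMod c ≠ 0) (hc : IsSquare (PadicInt.toZMod c)) : ∃ x : ℤ_[p], x ^ 2 = c := by
  obtain ⟨r, hr⟩ := hc
  obtain ⟨a, rfl⟩ := ZMod.ringHom_surjective (PadicInt.toZMod (p := p)) r
  have ha : PadicInt.toZMod a ≠ 0 := fun h => h0 (by rw [hr, h, zero_mul])
  obtain ⟨z, hz⟩ := PadicInt.exists_root_of_toZMod (X ^ 2 - C c) a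
    (by simp [hr, sq]) (by
      have : (X ^ 2 - C c).derivative.eval a = 2 * a := by simp [one_add_one_eq_two]
      rw [this, map_mul, map_ofNat]
      exact mul_ne_zero (ZMod.two_ne_zero_of_ne_two hp) ha)
  exact ⟨z, by simpa [sub_eq_zero] using hz⟩

/-- A binary form `a² - db²` with `d` a unit represents all `p`-adic units, `p` odd. -/
theorem PadicInt.exists_sq_sub_mul_sq_eq {p : ℕ} [Fact p.Prime] (hp : p ≠ 2) (d c : ℤ_[p])
    (hd : PadicInt.toZMod d ≠ 0) (hc : PadicInt.toZMod c ≠ 0) :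
    ∃ a b : ℤ_[p], a ^ 2 - d * b ^ 2 = c := by
  open Polynomial in
  obtain ⟨r, s, hrs⟩ := FiniteField.exists_root_sum_quadratic
    (f := (X ^ 2 - C (PadicInt.toZMod c) : (ZMod p)[X]))
    (g := C (-PadicInt.toZMod d) * X ^ 2) (degree_X_pow_sub_C (by decide) _)
    (degree_C_mul_X_pow 2 (neg_ne_zero.mpr hd))
    (by rw [ZMod.card]; exact (Fact.out : p.Prime).eq_two_or_odd.resolve_left hp)
  simp only [Polynomial.eval_sub, Polynomial.eval_pow, Polynomial.eval_X, Polynomial.eval_C,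
    Polynomial.eval_mul] at hrs
  obtain ⟨a, rfl⟩ := ZMod.ringHom_surjective (PadicInt.toZMod (p := p)) r
  obtain ⟨b, rfl⟩ := ZMod.ringHom_surjective (PadicInt.toZMod (p := p)) s
  by_cases ha : PadicInt.toZMod a = 0
  · -- lift the solution in the variable `b`, which is then a unit
    obtain ⟨e, he⟩ : IsUnit d := by
      by_contra h
      refine hd ?_
      rwa [← RingHom.mem_ker, PadicInt.ker_toZMod, IsLocalRing.mem_maximalIdeal]
    have hce : PadicInt.toZMod (c * -(↑e⁻¹ : ℤ_[p])) = PadicInt.toZMod b ^ 2 := by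
      have h1 : PadicInt.toZMod d * PadicInt.toZMod (↑e⁻¹ : ℤ_[p]) = 1 := by
        rw [← map_mul, ← he, Units.mul_inv, map_one]
      rw [ha] at hrs
      rw [map_mul, map_neg]
      linear_combination (-PadicInt.toZMod (↑e⁻¹ : ℤ_[p])) * -hrs + PadicInt.toZMod b ^ 2 * h1
    obtain ⟨x, hx⟩ := PadicInt.isSquare_of_toZMod hp (c * -(↑e⁻¹ : ℤ_[p]))
      (by
        rw [map_mul, map_neg]
        exact mul_ne_zero hc (neg_ne_zero.mpr ((Units.isUnit _).map _).ne_zero))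
      (by rw [hce]; exact IsSquare.sq _)
    refine ⟨0, x, ?_⟩
    have h1 : d * (↑e⁻¹ : ℤ_[p]) = 1 := by rw [← he, Units.mul_inv]
    rw [hx]
    linear_combination c * h1
  · obtain ⟨x, hx⟩ := PadicInt.isSquare_of_toZMod hp (c + d * b ^ 2)
      (by
        have : PadicInt.toZMod (c + d * b ^ 2) = PadicInt.toZMod a ^ 2 := by
          rw [map_add, map_mul, map_pow]; linear_combination -hrs
        rw [this]; exact pow_ne_zero _ ha)
      ⟨PadicInt.toZMod a, by rw [map_add, map_mul, map_pow]; linear_combination -hrs⟩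
    exact ⟨x, b, by rw [hx]; ring⟩

/-! ### Local solvability -/

/-- The equation `2w² - wb - mb² = ε` has a `2`-adic solution with `b = 1`: modulo `2` it is linear
in `w`, so Hensel's lemma applies. -/
theorem exists_two_adic_solution (m ε : ℤ_[2]) : ∃ w : ℤ_[2], 2 * w ^ 2 - w - m = ε := by
  have h2 : PadicInt.toZMod (2 : ℤ_[2]) = 0 := by rw [map_ofNat]; decide
  open Polynomial in
  obtain ⟨w, hw⟩ := PadicInt.exists_root_of_toZMod (C 2 * X ^ 2 - X - C (m + ε)) (-(m + ε))
    (by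
      have : (C 2 * X ^ 2 - X - C (m + ε)).eval (-(m + ε)) = 2 * (m + ε) ^ 2 := by
        simp only [eval_sub, eval_mul, eval_C, eval_pow, eval_X]; ring
      rw [this, map_mul, h2, zero_mul])
    (by
      have : (C 2 * X ^ 2 - X - C (m + ε)).derivative.eval (-(m + ε)) =
          2 * (-2 * (m + ε)) - 1 := by
        simp only [derivative_sub, derivative_C_mul, derivative_X_sq, derivative_X, derivative_C,
          eval_sub, eval_mul, eval_C, eval_X, eval_one, eval_zero]
        ring
      rw [this, map_sub, map_mul, h2, map_one, zero_mul]
      decide)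
  simp only [Polynomial.eval_sub, Polynomial.eval_mul, Polynomial.eval_C, Polynomial.eval_pow,
    Polynomial.eval_X] at hw
  exact ⟨w, by linear_combination hw⟩

theorem toZMod_eight_mul_ne_zero {p : ℕ} [Fact p.Prime] (hp : p ≠ 2) {ε : ℤ}
    (hε : ε = 1 ∨ ε = -1) : PadicInt.toZMod (8 * (ε : ℤ_[p])) ≠ 0 := by
  have h2 := ZMod.two_ne_zero_of_ne_two hp
  have h8 : (8 : ZMod p) ≠ 0 := by
    rw [show (8 : ZMod p) = 2 ^ 3 by norm_num]; exact pow_ne_zero _ h2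
  rw [map_mul, map_ofNat]
  rcases hε with rfl | rfl <;> simpa using h8

theorem legendreSym_two_mul_eq_one_iff {p : ℕ} [Fact p.Prime] (hp : p ≠ 2) {ε : ℤ}
    (hε : ε = 1 ∨ ε = -1) :
    legendreSym p (2 * ε) = 1 ↔ IsSquare (PadicInt.toZMod (8 * (ε : ℤ_[p]))) := by
  have h2 := ZMod.two_ne_zero_of_ne_two hp
  have hne : ((2 * ε : ℤ) : ZMod p) ≠ 0 := by rcases hε with rfl | rfl <;> simpa using h2
  rw [legendreSym.eq_one_iff p hne]
  have h8 : PadicInt.toZMod (8 * (ε : ℤ_[p])) = 2 ^ 2 * ((2 * ε : ℤ) : ZMod p) := by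
    rw [map_mul, map_ofNat, map_intCast]; push_cast; ring
  rw [h8]
  refine ⟨fun h => (IsSquare.sq _).mul h, fun ⟨r, hr⟩ => ⟨r / 2, ?_⟩⟩
  field_simp
  linear_combination hr

theorem exists_padic_solution_iff {p : ℕ} [Fact p.Prime] (hp : p ≠ 2) (d : ℕ) {ε : ℤ}
    (hε : ε = 1 ∨ ε = -1) :
    (∃ a b : ℤ_[p], a ^ 2 - (d : ℤ_[p]) * b ^ 2 = 8 * (ε : ℤ_[p])) ↔
      (p ∣ d → legendreSym p (2 * ε) = 1) := by
  rw [legendreSym_two_mul_eq_one_iff hp hε]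
  have h8 := toZMod_eight_mul_ne_zero hp hε
  constructor
  · rintro ⟨a, b, hab⟩ hpd
    have hd : (d : ZMod p) = 0 := (ZMod.natCast_eq_zero_iff d p).mpr hpd
    refine ⟨PadicInt.toZMod a, ?_⟩
    rw [← hab, map_sub, map_mul, map_natCast, hd, map_pow]
    ring
  · intro h
    by_cases hpd : p ∣ d
    · obtain ⟨x, hx⟩ := PadicInt.isSquare_of_toZMod hp _ h8 (h hpd)
      exact ⟨x, 0, by rw [hx]; ring⟩
    · refine PadicInt.exists_sq_sub_mul_sq_eq hp _ _ ?_ h8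
      rwa [map_natCast, Ne, ZMod.natCast_eq_zero_iff]

/-- `λ = (a + b√d) / 2` with `a = 4w - b` has norm `2ε` when `2w² - wb - mb² = ε`, `d = 8m + 1`. -/
theorem sq_sub_mul_sq_of_eq {R : Type*} [CommRing R] {d m w b ε : R} (hd : d = 8 * m + 1)
    (h : 2 * w ^ 2 - w * b - m * b ^ 2 = ε) : (4 * w - b) ^ 2 - d * b ^ 2 = 8 * ε := by
  subst hd; linear_combination 8 * h

/-- When `2` is invertible, every solution of `a² - db² = 8ε` has the form `a = 4w - b`. -/
theorem exists_eq_of_sq_sub_mul_sq {R : Type*} [CommRing R] (h2 : IsUnit (2 : R))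
    {d m a b ε : R} (hd : d = 8 * m + 1) (h : a ^ 2 - d * b ^ 2 = 8 * ε) :
    ∃ w : R, 2 * w ^ 2 - w * b - m * b ^ 2 = ε := by
  obtain ⟨c, hc⟩ := h2.exists_right_inv
  subst hd
  refine ⟨c ^ 2 * (a + b), (h2.pow 3).mul_left_cancel ?_⟩
  have h4 : 4 * c ^ 2 = 1 := by linear_combination (2 * c + 1) * hc
  linear_combination h + ((a + b) ^ 2 * (4 * c ^ 2 + 1) - 2 * (a + b) * b) * h4

theorem PadicInt.isUnit_two {p : ℕ} [Fact p.Prime] (hp : p ≠ 2) : IsUnit (2 : ℤ_[p]) := by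
  by_contra h
  apply ZMod.two_ne_zero_of_ne_two hp
  rw [← map_ofNat (PadicInt.toZMod (p := p)) 2]
  rwa [← RingHom.mem_ker, PadicInt.ker_toZMod, IsLocalRing.mem_maximalIdeal]

theorem exists_two_adic_sq_sub_mul_sq {d : ℕ} {m : ℤ} (hm : (d : ℤ) = 8 * m + 1) (ε : ℤ) :
    ∃ a b : ℤ_[2], a ^ 2 - (d : ℤ_[2]) * b ^ 2 = 8 * (ε : ℤ_[2]) := by
  obtain ⟨w, hw⟩ := exists_two_adic_solution (m : ℤ_[2]) ε
  exact ⟨4 * w - 1, 1, sq_sub_mul_sq_of_eq (m := (m : ℤ_[2]))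
    (by exact_mod_cast congrArg (Int.cast (R := ℤ_[2])) hm)
    (by linear_combination hw)⟩

/-! ### Base change of bilinear forms on `ℤⁿ` -/

/-- In the coordinates `R ⊗ ℤⁿ ≅ Rⁿ`, the base change of a form has the same Gram matrix. -/
theorem baseChange_toBilin'_apply {R ι : Type*} [CommRing R] [Fintype ι] [DecidableEq ι]
    (A : Matrix ι ι ℤ) (x y : R ⊗[ℤ] (ι → ℤ)) :
    LinearMap.BilinForm.baseChange R (Matrix.toBilin' A) x y =
      Matrix.toBilin' (A.map (Int.cast : ℤ → R)) (TensorProduct.piScalarRight ℤ R R ι x)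
        (TensorProduct.piScalarRight ℤ R R ι y) := by
  induction x with
  | zero => simp
  | add x₁ x₂ h₁ h₂ => simp only [map_add, LinearMap.add_apply, h₁, h₂]
  | tmul r u =>
    induction y with
    | zero => simp
    | add y₁ y₂ h₁ h₂ => simp only [map_add, h₁, h₂]
    | tmul s v =>
      simp only [LinearMap.BilinForm.baseChange_tmul, Matrix.toBilin'_apply,
        TensorProduct.piScalarRight_apply, TensorProduct.piScalarRightHom_tmul, Matrix.map_apply,
        zsmul_eq_mul, Int.cast_sum, Int.cast_mul, Finset.sum_mul]
      refine Finset.sum_congr rfl fun i _ => Finset.sum_congr rfl fun j _ => ?_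
      ring

/-- A change of basis over `R` between Gram matrices is an isometry of the base changes. -/
theorem isIsometric_baseChange_toBilin' {R ι : Type*} [CommRing R] [Fintype ι] [DecidableEq ι]
    (A B : Matrix ι ι ℤ) (P : Matrix ι ι R) (hP : IsUnit P.det)
    (h : P.transpose * B.map (Int.cast : ℤ → R) * P = A.map Int.cast) :
    IsIsometric (LinearMap.BilinForm.baseChange R (Matrix.toBilin' A))
      (LinearMap.BilinForm.baseChange R (Matrix.toBilin' B)) := by
  let φ := TensorProduct.piScalarRight ℤ R R ι
  let e : (ι → R) ≃ₗ[R] (ι → R) :=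
    Matrix.toLin'OfInv (Matrix.nonsing_inv_mul P hP) (Matrix.mul_nonsing_inv P hP)
  refine ⟨(φ.trans e).trans φ.symm, fun x y => ?_⟩
  rw [baseChange_toBilin'_apply, baseChange_toBilin'_apply, ← h, ← Matrix.toBilin'_comp]
  simp [φ, e, Matrix.toLin'OfInv]

theorem IsIsometric.symm {R M N : Type*} [CommRing R] [AddCommGroup M] [Module R M]
    [AddCommGroup N] [Module R N] {B : LinearMap.BilinForm R M} {C : LinearMap.BilinForm R N}
    (h : IsIsometric B C) : IsIsometric C B := by
  obtain ⟨e, he⟩ := h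
  exact ⟨e.symm, fun x y => by rw [← he, e.apply_symm_apply, e.apply_symm_apply]⟩

/-! ### The lattice representing `4ε` -/

/-- The lattice with Gram matrix `!![4ε, 1; 1, -2εm]`. For `ε = ±1` and `d = 8m + 1` it has
determinant `-d`, and its first basis vector has square `4ε`. -/
noncomputable def latticeGenus (m ε : ℤ) : LinearMap.BilinForm ℤ (Fin 2 → ℤ) :=
  Matrix.toBilin' !![4 * ε, 1; 1, -2 * ε * m]

theorem latticeGenus_isLatticeForm (m : ℤ) {ε : ℤ} (hε : ε = 1 ∨ ε = -1) :
    IsLatticeForm (latticeGenus m ε) where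
  free := inferInstance
  finite := inferInstance
  symm := ⟨fun x y => by
    simp [latticeGenus, Matrix.toBilin'_apply, Fin.sum_univ_two]; ring⟩
  nondegenerate := by
    refine LinearMap.BilinForm.nondegenerate_toBilin'_iff_det_ne_zero.mpr ?_
    rw [Matrix.det_fin_two_of]
    rcases hε with rfl | rfl <;> omega

/-- The isometry is multiplication by `λ / 2`, where `λ = (a + b√d) / 2`, `a = 4w - b`, has norm
`2ε`: in the bases `(2, εω)` and `(1, ω)` it has the matrix `P` below. -/
theorem isIsometric_baseChange_latticeGenus {R : Type*} [CommRing R] {d : ℕ} {m ε : ℤ}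
    (hε : ε = 1 ∨ ε = -1) (hm : (d : ℤ) = 8 * m + 1) {w b : R}
    (h : 2 * w ^ 2 - w * b - m * b ^ 2 = ε) :
    IsIsometric (LinearMap.BilinForm.baseChange R (latticeN2 d))
      (LinearMap.BilinForm.baseChange R (latticeGenus m ε)) := by
  have hq : (1 - (d : ℤ)) / 2 = -4 * m := by omega
  have hε2 : (ε : R) * ε = 1 := by rcases hε with rfl | rfl <;> simp
  refine (isIsometric_baseChange_toBilin' _ _ !![2 * w - b, ε * m * b; b, ε * w] ?_ ?_).symm
  · rw [Matrix.det_fin_two_of]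
    convert isUnit_one
    linear_combination (ε : R) * h + hε2
  · rw [hq]
    ext i j
    fin_cases i <;> fin_cases j <;>
      simp [Matrix.mul_apply, Fin.sum_univ_two]
    · linear_combination 4 * h
    · linear_combination (ε : R) * h + hε2
    · linear_combination (ε : R) * h + hε2
    · linear_combination (-2 * m * ε * ε : R) * h - 2 * m * ε * hε2

theorem exists_real_solution {d : ℕ} (hd : 0 < d) {ε : ℤ} (hε : ε = 1 ∨ ε = -1) :
    ∃ a b : ℝ, a ^ 2 - (d : ℝ) * b ^ 2 = 8 * (ε : ℝ) := by
  have hd' : (0 : ℝ) < d := by exact_mod_cast hd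
  rcases hε with rfl | rfl
  · exact ⟨√8, 0, by simp⟩
  · refine ⟨0, √(8 / d), ?_⟩
    rw [Real.sq_sqrt (by positivity)]
    field_simp
    simp

theorem sameGenus_latticeGenus {d : ℕ} {m ε : ℤ} (hε : ε = 1 ∨ ε = -1)
    (hm : (d : ℤ) = 8 * m + 1)
    (h : ∀ (p : ℕ) [Fact p.Prime], p ≠ 2 → p ∣ d → legendreSym p (2 * ε) = 1) :
    SameGenus (latticeN2 d) (latticeGenus m ε) := by
  refine ⟨fun p _ => ?_, ?_⟩
  · by_cases hp : p = 2
    · subst hp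
      obtain ⟨w, hw⟩ := exists_two_adic_solution (m : ℤ_[2]) ε
      exact isIsometric_baseChange_latticeGenus hε hm (w := w) (b := 1)
        (by linear_combination hw)
    · obtain ⟨a, b, hab⟩ := (exists_padic_solution_iff hp d hε).mpr (h p hp)
      obtain ⟨w, hw⟩ := exists_eq_of_sq_sub_mul_sq (PadicInt.isUnit_two hp) (m := (m : ℤ_[p]))
        (by exact_mod_cast congrArg (Int.cast (R := ℤ_[p])) hm) hab
      exact isIsometric_baseChange_latticeGenus hε hm hw
  · obtain ⟨a, b, hab⟩ := exists_real_solution (d := d) (by omega) hε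
    obtain ⟨w, hw⟩ := exists_eq_of_sq_sub_mul_sq (isUnit_iff_ne_zero.mpr two_ne_zero)
      (m := (m : ℝ)) (by exact_mod_cast congrArg (Int.cast (R := ℝ)) hm) hab
    exact isIsometric_baseChange_latticeGenus hε hm hw

/-! ### Vectors of square `4ε` and the Legendre symbols -/

theorem two_dvd_sub_of_sq_sub_mul_sq {d : ℕ} {m ε : ℤ} (hm : (d : ℤ) = 8 * m + 1) {p : ℕ}
    [Fact p.Prime] {a b : ℤ_[p]} (h : a ^ 2 - (d : ℤ_[p]) * b ^ 2 = 8 * (ε : ℤ_[p])) :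
    (2 : ℤ_[p]) ∣ a - b := by
  by_cases hp : p = 2
  · subst hp
    have h2 : Prime (2 : ℤ_[2]) := by exact_mod_cast PadicInt.prime_p (p := 2)
    have hm' : (d : ℤ_[2]) = 8 * m + 1 := by exact_mod_cast congrArg (Int.cast (R := ℤ_[2])) hm
    refine h2.dvd_of_dvd_pow (n := 2) ⟨4 * ε + 4 * m * b ^ 2 + b ^ 2 - a * b, ?_⟩
    rw [hm'] at h
    linear_combination h
  · exact (PadicInt.isUnit_two hp).dvd

theorem exists_solution_iff_baseChange_latticeN2 {d : ℕ} {m : ℤ} (hm : (d : ℤ) = 8 * m + 1)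
    (ε : ℤ) (p : ℕ) [Fact p.Prime] :
    (∃ a b : ℤ_[p], a ^ 2 - (d : ℤ_[p]) * b ^ 2 = 8 * (ε : ℤ_[p])) ↔
      (∃ z : ℤ_[p] ⊗[ℤ] (Fin 2 → ℤ),
        LinearMap.BilinForm.baseChange ℤ_[p] (latticeN2 d) z z = 4 * (ε : ℤ_[p])) := by
  have hq : (1 - (d : ℤ)) / 2 = -4 * m := by omega
  have hm' : (d : ℤ_[p]) = 8 * m + 1 := by exact_mod_cast congrArg (Int.cast (R := ℤ_[p])) hm
  let φ := TensorProduct.piScalarRight ℤ ℤ_[p] ℤ_[p] (Fin 2)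
  have hφ : ∀ z, LinearMap.BilinForm.baseChange ℤ_[p] (latticeN2 d) z z =
      2 * φ z 0 ^ 2 + 2 * φ z 0 * φ z 1 - 4 * m * φ z 1 ^ 2 := fun z => by
    rw [latticeN2, baseChange_toBilin'_apply, hq, Matrix.toBilin'_apply]
    simp [Fin.sum_univ_two, φ]
    ring
  constructor
  · rintro ⟨a, b, hab⟩
    obtain ⟨u, hu⟩ := two_dvd_sub_of_sq_sub_mul_sq hm hab
    refine ⟨φ.symm ![u, b], mul_left_cancel₀ (two_ne_zero (α := ℤ_[p])) ?_⟩
    rw [hφ, φ.apply_symm_apply]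
    simp only [Matrix.cons_val_zero, Matrix.cons_val_one]
    rw [hm', sub_eq_iff_eq_add.mp hu] at hab
    linear_combination hab
  · rintro ⟨z, hz⟩
    refine ⟨2 * φ z 0 + φ z 1, φ z 1, ?_⟩
    rw [hφ] at hz
    rw [hm']
    linear_combination 2 * hz

theorem exists_solution_of_isIsometric {d : ℕ} {m ε : ℤ} (hm : (d : ℤ) = 8 * m + 1)
    (h : IsIsometric (latticeN2 d) (latticeGenus m ε)) :
    ∃ a b : ℤ, a ^ 2 - (d : ℤ) * b ^ 2 = 8 * ε := by
  obtain ⟨e, he⟩ := h.symm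
  have hq : (1 - (d : ℤ)) / 2 = -4 * m := by omega
  have h0 := he ![1, 0] ![1, 0]
  rw [latticeN2_apply, hq] at h0
  simp only [latticeGenus, Matrix.toBilin'_apply, Fin.sum_univ_two] at h0
  simp only [Matrix.of_apply, Matrix.cons_val_zero, Matrix.cons_val_one, Matrix.cons_val',
    Matrix.cons_val_fin_one] at h0
  refine ⟨2 * e ![1, 0] 0 + e ![1, 0] 1, e ![1, 0] 1, ?_⟩
  rw [hm]
  linear_combination 2 * h0

/-- The supplementary laws, with the characters mod `8` rewritten as signs. The parities of the
exponents depend only on `p` modulo `8`. -/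
theorem legendreSym_two_and_neg_two (p : ℕ) [Fact p.Prime] (hp : p ≠ 2) :
    legendreSym p 2 = (-1) ^ ((p ^ 2 - 1) / 8) ∧
      legendreSym p (-2) = (-1) ^ ((p ^ 2 - 1) / 8 + (p - 1) / 2) := by
  have hodd : p % 2 = 1 := (Fact.out : p.Prime).eq_two_or_odd.resolve_left hp
  rw [legendreSym.at_two hp, legendreSym.at_neg_two hp, ZMod.χ₈_nat_eq_if_mod_eight,
    ZMod.χ₈'_nat_eq_if_mod_eight]
  obtain ⟨k, r, hr, rfl⟩ : ∃ k r, (r = 1 ∨ r = 3 ∨ r = 5 ∨ r = 7) ∧ p = 8 * k + r :=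
    ⟨p / 8, p % 8, by omega, by omega⟩
  have hexp : ∀ s, r ^ 2 = 8 * s + 1 →
      ((8 * k + r) ^ 2 - 1) / 8 = 2 * (4 * k ^ 2 + k * r) + s := fun s hs => by
    have : (8 * k + r) ^ 2 = 8 * (2 * (4 * k ^ 2 + k * r) + s) + 1 := by
      linear_combination hs
    omega
  have hhalf : (8 * k + r - 1) / 2 = 2 * (2 * k) + (r - 1) / 2 := by omega
  rw [hhalf]
  rcases hr with rfl | rfl | rfl | rfl
  · rw [hexp 0 (by norm_num)]; simp [pow_add, pow_mul, Nat.add_mod, Nat.mul_mod]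
  · rw [hexp 1 (by norm_num)]; simp [pow_add, pow_mul, Nat.add_mod, Nat.mul_mod]
  · rw [hexp 3 (by norm_num)]; simp [pow_add, pow_mul, Nat.add_mod, Nat.mul_mod]
  · rw [hexp 6 (by norm_num)]; simp [pow_add, pow_mul, Nat.add_mod, Nat.mul_mod]

theorem proposition3p2p4 (d : ℕ) (hd : d ≡ 1 [MOD 8]) (ε : ℤ) (hε : ε = 1 ∨ ε = -1) :
    -- solvability over the `p`-adic integers for all `p` is the Legendre condition
    ((∀ (p : ℕ) [Fact p.Prime], ∃ a b : ℤ_[p], a ^ 2 - (d : ℤ_[p]) * b ^ 2 = 8 * (ε : ℤ_[p])) ↔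
      (∀ (p : ℕ) [Fact p.Prime], p ≠ 2 → p ∣ d → legendreSym p (2 * ε) = 1)) ∧
    -- for each `p`, the equivalent formulation in terms of the lattice over `ℤ_p`
    (∀ (p : ℕ) [Fact p.Prime],
      (∃ a b : ℤ_[p], a ^ 2 - (d : ℤ_[p]) * b ^ 2 = 8 * (ε : ℤ_[p])) ↔
      (∃ z : ℤ_[p] ⊗[ℤ] (Fin 2 → ℤ),
        LinearMap.BilinForm.baseChange ℤ_[p] (latticeN2 d) z z = 4 * (ε : ℤ_[p]))) ∧
    -- the explicit values of the Legendre symbols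
    (∀ (p : ℕ) [Fact p.Prime], p ≠ 2 →
      legendreSym p 2 = (-1) ^ ((p ^ 2 - 1) / 8) ∧
      legendreSym p (-2) = (-1) ^ ((p ^ 2 - 1) / 8 + (p - 1) / 2)) ∧
    -- the one-class case
    (GenusHasOneClass (latticeN2 d) →
      ((∃ a b : ℤ, a ^ 2 - (d : ℤ) * b ^ 2 = 8 * ε) ↔
        (∀ (p : ℕ) [Fact p.Prime], p ≠ 2 → p ∣ d → legendreSym p (2 * ε) = 1))) := by
  obtain ⟨m, hm⟩ : ∃ m : ℤ, (d : ℤ) = 8 * m + 1 := by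
    unfold Nat.ModEq at hd
    exact ⟨(d : ℤ) / 8, by omega⟩
  have hlocal : (∀ (p : ℕ) [Fact p.Prime],
        ∃ a b : ℤ_[p], a ^ 2 - (d : ℤ_[p]) * b ^ 2 = 8 * (ε : ℤ_[p])) ↔
      (∀ (p : ℕ) [Fact p.Prime], p ≠ 2 → p ∣ d → legendreSym p (2 * ε) = 1) := by
    refine ⟨fun h p _ hp => (exists_padic_solution_iff hp d hε).mp (h p), fun h p _ => ?_⟩
    by_cases hp : p = 2
    · subst hp
      exact exists_two_adic_sq_sub_mul_sq hm ε
    · exact (exists_padic_solution_iff hp d hε).mpr (h p hp)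
  refine ⟨hlocal, fun p _ => exists_solution_iff_baseChange_latticeN2 hm ε p,
    fun p _ hp => legendreSym_two_and_neg_two p hp, fun hone => ⟨?_, fun h => ?_⟩⟩
  · rintro ⟨a, b, hab⟩
    exact hlocal.mp fun p _ => ⟨a, b, by exact_mod_cast congrArg (Int.cast (R := ℤ_[p])) hab⟩
  · exact exists_solution_of_isIsometric hm (hone _ _ (latticeGenus_isLatticeForm m hε)
      (sameGenus_latticeGenus hε hm h))
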